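/- Let $m\ge 1$ and let $X\subseteq\{0,1\}^m$ be a set such that for every $j\in\{1,\dots,m\}$ both values $0$ and $1$ occur as the $j$-th coordinate of some element of $X$. For $n\ge 2$, an $n$-ary aggregator for $X$ is a tuple $\bar f=(f_1,\dots,f_m)$ of functions $f_j:\{0,1\}^n\to\{0,1\}$ such that (i) $f_j(a_1,\dots,a_n)\in\{a_1,\dots,a_n\}$ for all $j$ and all $a_1,\dots,a_n\in\{0,1\}$, and (ii) for all $x^1,\dots,x^n\in X$ the tuple $\bar f(x^1,\dots,x^n):=\big(f_1(x^1_1,\dots,x^n_1),\dots,f_m(x^1_m,\dots,x^n_m)\big)$ belongs to $X$. It is dictatorial on $X$ if there is $d\in\{1,\dots,n\}$ with $\bar f(x^1,\dots,x^n)=x^d$ for all $x^1,\dots,x^n\in X$, and non-dictatorial otherwise. The set $X$ is a possibility domain if it has a non-dictatorial aggregator of some arity $n\ge 2$. It is affine if $x\oplus y\oplus z\in X$ for all $x,y,z\in X$, where $\oplus$ is coordinatewise addition modulo $2$. There is a polynomial-time algorithm (a Turing machine whose running time is bounded by a polynomial in the length of its input) which, given such a set $X$ explicitly by a list of its elements,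 for arbitrary $m\ge 1$, decides whether $X$ is a possibility domain. It answers "yes" exactly when $X$ admits a binary (that is, $2$-ary) non-dictatorial aggregator or $X$ is affine. -/

import Mathlib

namespace Aggregation

/-- An evaluation on `m` issues in the Boolean framework: an element of `{0,1}^m`. -/
abbrev Evaluation (m : ℕ) : Type := Fin m → Bool

/-- Non-degeneracy of a set of feasible evaluations: for each issue `j`, the projection `X_j`
of `X` has at least two elements. -/
def Nondegenerate {m : ℕ} (X : Set (Evaluation m)) : Prop :=
  ∀ j : Fin m, ((fun x : Evaluation m => x j) '' X).Nontrivial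

/-- Issue-by-issue aggregation of the evaluations `x 0, …, x (n-1)` of `n` individuals:
the `j`-th component is `f j` applied to the column of opinions on issue `j`. -/
def aggregate {m n : ℕ} (f : Fin m → (Fin n → Bool) → Bool) (x : Fin n → Evaluation m) :
    Evaluation m :=
  fun j => f j (fun i => x i j)

/-- `f = (f_1, …, f_m)` is an `n`-ary aggregator for `X`: every component is conservative, and
aggregating feasible evaluations gives a feasible evaluation. -/
structure IsAggregator {m n : ℕ} (X : Set (Evaluation m))
    (f : Fin m → (Fin n → Bool) → Bool) : Prop where
  conservative : ∀ (j : Fin m) (a : Fin n → Bool), ∃ i : Fin n, f j a = a i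
  closed : ∀ x : Fin n → Evaluation m, (∀ i, x i ∈ X) → aggregate f x ∈ X

/-- `f` restricted to `X` is the projection to one individual `d`, the same for all issues. -/
def IsDictatorialOn {m n : ℕ} (X : Set (Evaluation m))
    (f : Fin m → (Fin n → Bool) → Bool) : Prop :=
  ∃ d : Fin n, ∀ x : Fin n → Evaluation m, (∀ i, x i ∈ X) → aggregate f x = x d

/-- `X` admits an `n`-ary non-dictatorial aggregator. -/
def AdmitsNonDictatorial {m : ℕ} (X : Set (Evaluation m)) (n : ℕ) : Prop :=
  ∃ f : Fin m → (Fin n → Bool) → Bool, IsAggregator X f ∧ ¬ IsDictatorialOn X f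

/-- `X` is a possibility domain: it has a non-dictatorial aggregator of some arity `n ≥ 2`. -/
def IsPossibilityDomain {m : ℕ} (X : Set (Evaluation m)) : Prop :=
  ∃ n : ℕ, 2 ≤ n ∧ AdmitsNonDictatorial X n

/-- `X` is affine: it is closed under the coordinatewise ternary operation `x ⊕ y ⊕ z`. -/
def IsAffine {m : ℕ} (X : Set (Evaluation m)) : Prop :=
  ∀ x ∈ X, ∀ y ∈ X, ∀ z ∈ X, (fun j => xor (xor (x j) (y j)) (z j)) ∈ X

/-- An input of the decision problem: a non-degenerate set of feasible evaluations on `m ≥ 1`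
issues, given explicitly by a list of its elements (in any order; repetitions are harmless). -/
structure Instance where
  m : ℕ
  m_pos : 1 ≤ m
  rows : List (Evaluation m)
  nondegenerate : Nondegenerate {x | x ∈ rows}

/-- The set of feasible evaluations that an input lists. -/
def Instance.X (I : Instance) : Set (Evaluation I.m) := {x | x ∈ I.rows}

/-- The input word, over the three-letter alphabet `0`, `1` (as `some b`) and an end-of-row
marker (`none`): the listed evaluations are written out one after the other. -/
def Instance.encode (I : Instance) : List (Option Bool) :=
  I.rows.flatMap fun x => (List.ofFn x).map some ++ [none]

end Aggregation

/-!
Suppose that `X` has no binary non-dictatorial aggregator. Merging the individuals into two blocs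
shows that the components of any aggregator of `X` coincide and commute with complementation.
Merging them into three blocs gives a ternary operation that preserves `X`; unless the aggregator
is additive on disjoint coalitions, it generates the majority, which becomes a binary
non-dictatorial aggregator when one argument is fixed, or it is the sum modulo 2. So if `X` is not
affine, the winning coalitions form an ultrafilter on a finite set, and the aggregator is
dictatorial.

A conservative binary operation `f` is determined by the literals `(j, b)` with `f j (b, ¬b) = b`.
It is an aggregator if and only if this set of literals is closed under a monotone forcing rule
given by `X`, and the dictatorships are the empty set and the set of all literals. Up to exchanging
the two arguments the set contains a literal of the first issue, so it suffices to close each of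
the two literals of this issue and to see whether the result is full. Every round of applications
of the rule that is not the last one adds a literal, so `2 * m` rounds are enough.

The closure and the test for affineness are nested loops over the rows of the input with a bounded
amount of memory for each issue. Such programs run in polynomial time on a machine with stacks:
every loop keeps its position in the input on two stacks of its own, and two further stacks form a
tape with one cell for each issue.
-/

namespace Aggregation

variable {m n : ℕ} {X : Set (Evaluation m)}

/-! ### Reduction to binary aggregators and affine sets -/

theorem Nondegenerate.exists_apply_eq (hX : Nondegenerate X) (j : Fin m) (b : Bool) :
    ∃ x ∈ X, x j = b := by
  obtain ⟨_, ⟨x, hx, rfl⟩, hne⟩ := (hX j).exists_ne (!b)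
  exact ⟨x, hx, by simpa using hne⟩

theorem Nondegenerate.isDictatorialOn_iff (hX : Nondegenerate X)
    (f : Fin m → (Fin n → Bool) → Bool) :
    IsDictatorialOn X f ↔ ∃ d, ∀ j a, f j a = a d := by
  constructor
  · rintro ⟨d, hd⟩
    refine ⟨d, fun j a => ?_⟩
    choose x hx hxa using fun i => hX.exists_apply_eq j (a i)
    simpa only [aggregate, hxa] using congrFun (hd x hx) j
  · rintro ⟨d, hd⟩
    exact ⟨d, fun x _ => funext fun j => hd j _⟩

theorem IsAggregator.minor {k : ℕ} {f : Fin m → (Fin n → Bool) → Bool} (hf : IsAggregator X f)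
    (π : Fin n → Fin k) : IsAggregator X (fun j a => f j (a ∘ π)) where
  conservative j a := (hf.conservative j (a ∘ π)).imp' π fun _ hi => hi
  closed x hx := hf.closed (x ∘ π) fun i => hx (π i)

/-- `X` is preserved by the ternary operation `t`, applied in every coordinate. -/
def PreservedBy (X : Set (Evaluation m)) (t : Bool → Bool → Bool → Bool) : Prop :=
  ∀ x ∈ X, ∀ y ∈ X, ∀ z ∈ X, (fun j => t (x j) (y j) (z j)) ∈ X

/-- The majority of three bits. -/
def majority (x y z : Bool) : Bool := (x && y) || (x && z) || (y && z)

-- Fixing the third argument of the majority makes every issue a conjunction or a disjunction.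
theorem PreservedBy.admitsNonDictatorial_two [NeZero m] (hX : Nondegenerate X)
    (h : PreservedBy X majority) : AdmitsNonDictatorial X 2 := by
  obtain ⟨z, hz, -⟩ := hX.exists_apply_eq 0 true
  refine ⟨fun j a => majority (a 0) (a 1) (z j), ⟨fun j a => ?_, fun x hx => ?_⟩, ?_⟩
  · cases h0 : a 0 <;> cases h1 : a 1 <;> cases z j <;>
      simp [majority, Fin.exists_fin_two, h0, h1]
  · exact h _ (hx 0) _ (hx 1) _ hz
  · rw [hX.isDictatorialOn_iff]
    rintro ⟨d, hd⟩
    have h10 := hd 0 ![true, false]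
    have h01 := hd 0 ![false, true]
    revert h10 h01
    fin_cases d <;> cases z 0 <;> simp [majority]

theorem IsAffine.admitsNonDictatorial_three [NeZero m] (hX : Nondegenerate X) (h : IsAffine X) :
    AdmitsNonDictatorial X 3 := by
  refine ⟨fun _ a => xor (xor (a 0) (a 1)) (a 2), ⟨fun _ a => ?_, fun x hx => ?_⟩, ?_⟩
  · cases h0 : a 0 <;> cases h1 : a 1 <;> cases h2 : a 2 <;>
      simp [Fin.exists_fin_succ, h0, h1, h2]
  · exact h _ (hx 0) _ (hx 1) _ (hx 2)
  · rw [hX.isDictatorialOn_iff]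
    rintro ⟨d, hd⟩
    have h100 := hd 0 ![true, false, false]
    have h010 := hd 0 ![false, true, false]
    revert h100 h010
    fin_cases d <;> simp

theorem IsAggregator.exists_eq_of_coalition (hX : Nondegenerate X)
    (hB : ¬ AdmitsNonDictatorial X 2) {f : Fin m → (Fin n → Bool) → Bool} (hf : IsAggregator X f)
    (a : Fin n → Bool) :
    ∃ d : Fin 2, ∀ j (b : Fin 2 → Bool), f j (fun i => if a i then b 0 else b 1) = b d := by
  have hd : IsDictatorialOn X fun j (b : Fin 2 → Bool) => f j (b ∘ fun i => if a i then 0 else 1) :=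
    by_contra fun h => hB ⟨_, hf.minor _, h⟩
  obtain ⟨d, hd⟩ := (hX.isDictatorialOn_iff _).1 hd
  refine ⟨d, fun j b => ?_⟩
  simpa only [Function.comp_def, apply_ite b] using hd j b

theorem IsAggregator.apply_eq_apply (hX : Nondegenerate X) (hB : ¬ AdmitsNonDictatorial X 2)
    {f : Fin m → (Fin n → Bool) → Bool} (hf : IsAggregator X f) (j k : Fin m) (a : Fin n → Bool) :
    f j a = f k a := by
  obtain ⟨d, hd⟩ := hf.exists_eq_of_coalition hX hB a
  simpa using (hd j ![true, false]).trans (hd k ![true, false]).symm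

theorem IsAggregator.apply_compl (hX : Nondegenerate X) (hB : ¬ AdmitsNonDictatorial X 2)
    {f : Fin m → (Fin n → Bool) → Bool} (hf : IsAggregator X f) (j : Fin m) (a : Fin n → Bool) :
    f j aᶜ = !f j a := by
  obtain ⟨d, hd⟩ := hf.exists_eq_of_coalition hX hB a
  have h10 : f j a = ![true, false] d := by simpa using hd j ![true, false]
  have h01 : f j aᶜ = ![false, true] d := by
    rw [← hd j ![false, true]]
    congr 1
    funext i
    cases h : a i <;> simp [h]
  rw [h10, h01]
  fin_cases d <;> rfl

theorem monotone_of_additive {β : Type*} [GeneralizedBooleanAlgebra β] {W : β → Bool}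
    (hsup : ∀ a b, Disjoint a b → W (a ⊔ b) = (W a || W b)) : Monotone W := fun a b hab => by
  rw [← sup_sdiff_cancel_right hab, hsup _ _ disjoint_sdiff_self_right]
  exact le_sup_left

theorem apply_inf_of_additive {β : Type*} [BooleanAlgebra β] {W : β → Bool}
    (hcompl : ∀ a, W aᶜ = !W a) (hsup : ∀ a b, Disjoint a b → W (a ⊔ b) = (W a || W b)) {a b : β}
    (ha : W a = true) (hb : W b = true) : W (a ⊓ b) = true := by
  have hdiff : W (a \ b) = false := by
    have hle : W b ≤ W (a \ b)ᶜ :=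
      monotone_of_additive hsup (le_compl_iff_disjoint_left.2 disjoint_sdiff_self_left)
    simpa [hcompl] using Bool.le_iff_imp.1 hle hb
  rwa [← sup_inf_sdiff a b, hsup _ _ disjoint_inf_sdiff, hdiff, Bool.or_false] at ha

-- The sets on which `W` is true form an ultrafilter, which is principal on a finite type.
theorem exists_eq_apply_of_additive {ι : Type*} [Finite ι] {W : (ι → Bool) → Bool}
    (hcompl : ∀ a, W aᶜ = !W a)
    (hsup : ∀ a b, Disjoint a b → W (a ⊔ b) = (W a || W b)) : ∃ d, ∀ a, W a = a d := by
  have hmono : ∀ a b, a ≤ b → W a = true → W b = true := fun a b hab =>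
    Bool.le_iff_imp.1 (monotone_of_additive hsup hab)
  have htop : W ⊤ = true := by
    cases h : W ⊤
    · exact (hmono ⊥ ⊤ bot_le (by simpa [h] using hcompl ⊤)).symm.trans h |>.symm
    · rfl
  classical
  let F : Filter ι :=
    { sets := {s | W (fun i => decide (i ∈ s)) = true}
      univ_sets := by simpa [Pi.top_def] using htop
      sets_of_superset := fun {s t} hs hst => hmono _ _ (fun i => by
        simpa [Bool.le_iff_imp] using @hst i) hs
      inter_sets := fun {s t} hs ht => by
        simpa [Pi.inf_def] using apply_inf_of_additive hcompl hsup hs ht }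
  have hF : ∀ s, sᶜ ∉ F ↔ s ∈ F := fun s => by
    have hs : (W fun i => !decide (i ∈ s)) = !W fun i => decide (i ∈ s) := hcompl _
    simp [F, ← Filter.mem_sets, hs]
  obtain ⟨d, hd⟩ := (Ultrafilter.ofComplNotMemIff F hF).eq_pure_of_finite
  refine ⟨d, fun a => Bool.eq_iff_iff.2 ?_⟩
  have : {i | a i = true} ∈ Ultrafilter.ofComplNotMemIff F hF ↔ a d = true := by
    rw [hd, Ultrafilter.mem_pure, Set.mem_ofPred_eq]
  rw [← this]
  change _ ↔ W _ = true
  simp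

theorem ternary_cases_of_selfDual {t : Bool → Bool → Bool → Bool}
    (hnot : ∀ x y z, t (!x) (!y) (!z) = !t x y z) (htrue : t true true true = true) :
    t true true false = (t true false false || t false true false) ∨
      t = majority ∨ (fun x y z => t (t y x z) x z) = majority ∨
      (fun x y z => t x (t x y z) z) = majority ∨ t = fun x y z => xor (xor x y) z := by
  have h000 := hnot true true true
  have h011 := hnot true false false
  have h101 := hnot false true false
  have h001 := hnot true true false
  simp only [Bool.not_true, Bool.not_false, htrue] at h000 h011 h101 h001
  simp only [funext_iff, Bool.forall_bool, majority]
  cases h100 : t true false false <;> cases h010 : t false true false <;>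
    cases h110 : t true true false <;> simp [*]

theorem PreservedBy.map_or_of_not_isAffine [NeZero m] (hX : Nondegenerate X)
    (hB : ¬ AdmitsNonDictatorial X 2) (hA : ¬ IsAffine X) {t : Bool → Bool → Bool → Bool}
    (ht : PreservedBy X t) (hnot : ∀ x y z, t (!x) (!y) (!z) = !t x y z)
    (htrue : t true true true = true) :
    t true true false = (t true false false || t false true false) := by
  have hmaj : ¬ PreservedBy X majority := fun h => hB (h.admitsNonDictatorial_two hX)
  rcases ternary_cases_of_selfDual hnot htrue with h | h | h | h | h
  · exact h
  · exact (hmaj (h ▸ ht)).elim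
  · exact (hmaj (h ▸ fun x hx y hy z hz => ht _ (ht y hy x hx z hz) x hx z hz)).elim
  · exact (hmaj (h ▸ fun x hx y hy z hz => ht x hx _ (ht x hx y hy z hz) z hz)).elim
  · subst h
    exact (hA ht).elim

theorem IsAggregator.preservedBy (hX : Nondegenerate X) (hB : ¬ AdmitsNonDictatorial X 2)
    {f : Fin m → (Fin n → Bool) → Bool} (hf : IsAggregator X f) (k : Fin m) (a b : Fin n → Bool) :
    PreservedBy X fun x y z => f k fun i => if a i then x else if b i then y else z := by
  intro x hx y hy z hz
  have hmem := hf.closed (fun i => if a i then x else if b i then y else z) fun i => by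
    split_ifs <;> assumption
  convert hmem using 1
  funext j
  refine .trans (congrArg (f k) (funext fun i => ?_)) (hf.apply_eq_apply hX hB k j _)
  dsimp only
  split_ifs <;> rfl

theorem IsAggregator.apply_sup_of_disjoint [NeZero m] (hX : Nondegenerate X)
    (hB : ¬ AdmitsNonDictatorial X 2) (hA : ¬ IsAffine X) {f : Fin m → (Fin n → Bool) → Bool}
    (hf : IsAggregator X f) (k : Fin m) {a b : Fin n → Bool} (hab : Disjoint a b) :
    f k (a ⊔ b) = (f k a || f k b) := by
  have h := (hf.preservedBy hX hB k a b).map_or_of_not_isAffine hX hB hA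
    (fun x y z => ?_) ?_
  · have hsup : (fun i => if a i then true else if b i then true else false) = a ⊔ b := by
      funext i
      cases ha : a i <;> cases hb : b i <;> simp [ha, hb]
    have hright : (fun i => if a i then false else if b i then true else false) = b := by
      funext i
      have hi : Disjoint (a i) (b i) := Pi.disjoint_iff.1 hab i
      revert hi
      cases a i <;> cases b i <;> simp
    rw [hsup, hright] at h
    simpa using h
  · rw [← hf.apply_compl hX hB]
    congr 1
    funext i
    simp only [Pi.compl_apply, Bool.compl_eq_bnot]
    split_ifs <;> rfl
  · obtain ⟨_, hi⟩ := hf.conservative k fun _ => true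
    simpa using hi

theorem AdmitsNonDictatorial.isAffine [NeZero m] (hX : Nondegenerate X)
    (hB : ¬ AdmitsNonDictatorial X 2) (h : AdmitsNonDictatorial X n) : IsAffine X := by
  by_contra hA
  obtain ⟨f, hf, hnd⟩ := h
  obtain ⟨d, hd⟩ := exists_eq_apply_of_additive (hf.apply_compl hX hB 0)
    fun a b => hf.apply_sup_of_disjoint hX hB hA 0
  exact hnd ((hX.isDictatorialOn_iff f).2
    ⟨d, fun j a => (hf.apply_eq_apply hX hB j 0 a).trans (hd a)⟩)

theorem isPossibilityDomain_iff [NeZero m] (hX : Nondegenerate X) :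
    IsPossibilityDomain X ↔ AdmitsNonDictatorial X 2 ∨ IsAffine X := by
  constructor
  · rintro ⟨n, -, h⟩
    by_cases hB : AdmitsNonDictatorial X 2
    · exact Or.inl hB
    · exact Or.inr (h.isAffine hX hB)
  · rintro (h | h)
    · exact ⟨2, le_rfl, h⟩
    · exact ⟨3, by norm_num, h.admitsNonDictatorial_three hX⟩

end Aggregation

namespace Aggregation

/-! ### Binary aggregators as closed sets of literals -/

/-- A literal `(j, b)` fixes the value `b` on the issue `j`. -/
abbrev Literal (m : ℕ) : Type := Fin m × Bool

variable {m : ℕ} {X : Set (Evaluation m)} {S T : Set (Literal m)}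

/-- The literals `(j, b)` for which `f j` sends `(b, !b)` to `b`. Together they determine a
conservative binary `f`. -/
def literals (f : Fin m → (Fin 2 → Bool) → Bool) : Set (Literal m) :=
  {p | f p.1 ![p.2, !p.2] = p.2}

open Classical in
/-- The conservative binary operations whose set of literals is `S`. -/
noncomputable def op (S : Set (Literal m)) (j : Fin m) (a : Fin 2 → Bool) : Bool :=
  if (j, a 0) ∈ S then a 0 else a 1

theorem literals_op (S : Set (Literal m)) : literals (op S) = S := by
  ext ⟨j, b⟩
  by_cases h : (j, b) ∈ S <;> simp [literals, op, h]

theorem IsAggregator.op_literals {f : Fin m → (Fin 2 → Bool) → Bool} (hf : IsAggregator X f) :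
    op (literals f) = f := by
  funext j a
  obtain ⟨i, hi⟩ := hf.conservative j a
  have ha : a = ![a 0, a 1] := List.ofFn_inj.1 rfl
  rw [ha] at hi ⊢
  generalize a 0 = x, a 1 = y at hi ⊢
  cases x <;> cases y <;> fin_cases i <;> simp_all [op, literals]

theorem Nondegenerate.isDictatorialOn_op_iff (hX : Nondegenerate X) :
    IsDictatorialOn X (op S) ↔ S = Set.univ ∨ S = ∅ := by
  rw [hX.isDictatorialOn_iff]
  constructor
  · rintro ⟨d, hd⟩
    rw [← literals_op S]
    fin_cases d
    · exact Or.inl (Set.eq_univ_of_forall fun p => by simp [literals, hd])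
    · exact Or.inr (Set.eq_empty_of_forall_notMem fun p => by simp [literals, hd])
  · rintro (rfl | rfl)
    · exact ⟨0, fun j a => by simp [op]⟩
    · exact ⟨1, fun j a => by simp [op]⟩

/-- `y` agrees with `z` on every issue on which the operations of `S` send the opinions in `z` and
`z'` to the one in `z`. -/
def Admissible (S : Set (Literal m)) (z z' y : Evaluation m) : Prop :=
  ∀ k, z k = z' k ∨ (k, z k) ∈ S → y k = z k

/-- The literals of `z`, on issues on which `z'` differs from `z`, that hold in all admissible
elements of `X`. -/
def forced (X : Set (Evaluation m)) (S : Set (Literal m)) (z z' : Evaluation m) :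
    Set (Literal m) :=
  {p | z p.1 = p.2 ∧ z' p.1 ≠ p.2 ∧ ∀ y ∈ X, Admissible S z z' y → y p.1 = p.2}

/-- `S` contains all literals that it forces. The closed sets turn out to be the sets of literals
of the binary aggregators. -/
def Closed (X : Set (Evaluation m)) (S : Set (Literal m)) : Prop :=
  ∀ z ∈ X, ∀ z' ∈ X, forced X S z z' ⊆ S

theorem forced_mono (hST : S ⊆ T) (z z' : Evaluation m) : forced X S z z' ⊆ forced X T z z' :=
  fun _ ⟨hz, hz', h⟩ =>
    ⟨hz, hz', fun y hy hadm => h y hy fun k hk => hadm k (hk.imp_right (@hST _))⟩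

theorem IsAggregator.closed_literals {f : Fin m → (Fin 2 → Bool) → Bool} (hf : IsAggregator X f) :
    Closed X (literals f) := by
  classical
  intro z hz z' hz' p ⟨hzp, hne, h⟩
  have happly (k : Fin m) : aggregate f ![z, z'] k =
      if (k, z k) ∈ literals f then z k else z' k := by
    rw [← hf.op_literals, literals_op]
    rfl
  have hmem : aggregate f ![z, z'] ∈ X :=
    hf.closed ![z, z'] (by simp [Fin.forall_fin_two, hz, hz'])
  have hp := h _ hmem fun k hk => by
    rw [happly, ite_eq_left_iff]
    exact fun hk' => (hk.resolve_right hk').symm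
  rw [happly, hzp] at hp
  by_contra hnot
  exact hne (by rwa [if_neg hnot] at hp)

open Classical in
-- Induction on the number of issues on which `z` and `z'` differ: an admissible element of `X`
-- that is not excluded by `forced` can replace `z`.
theorem Closed.ite_mem (hS : Closed X S) {z z' : Evaluation m} (hz : z ∈ X) (hz' : z' ∈ X) :
    (fun j => if (j, z j) ∈ S then z j else z' j) ∈ X := by
  induction h : hammingDist z z' using Nat.strong_induction_on generalizing z with
  | _ d ih =>
    subst h
    by_cases hall : ∀ q, z q ≠ z' q → (q, z q) ∈ S
    · convert hz using 1
      funext j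
      split_ifs with hj
      · rfl
      · exact (not_imp_comm.1 (hall j) hj).symm
    push Not at hall
    obtain ⟨q, hne, hq⟩ := hall
    obtain ⟨y, hy, hadm, hyq⟩ : ∃ y ∈ X, Admissible S z z' y ∧ y q ≠ z q := by
      by_contra! h
      exact hq (hS z hz z' hz' ⟨rfl, hne.symm, h⟩)
    have hlt : hammingDist y z' < hammingDist z z' := by
      refine Finset.card_lt_card (Finset.ssubset_iff_of_subset (fun k => ?_) |>.2 ⟨q, ?_⟩)
      · simp only [Finset.mem_filter, Finset.mem_univ, true_and]
        exact mt fun hk => (hadm k (Or.inl hk)).trans hk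
      · simpa [hne] using (Bool.eq_not_of_ne hyq).trans (Bool.eq_not_of_ne hne.symm).symm
    convert ih _ hlt hy rfl using 1
    funext j
    by_cases hj : z j = z' j ∨ (j, z j) ∈ S
    · rw [hadm j hj]
    · obtain ⟨hj, hjS⟩ := not_or.1 hj
      rw [if_neg hjS]
      split_ifs with hjy
      · exact (Bool.eq_not_of_ne (Ne.symm hj)).trans
          (Bool.eq_not_of_ne fun hy => hjS (by rwa [← hy])).symm
      · rfl

theorem Closed.isAggregator_op (hS : Closed X S) : IsAggregator X (op S) where
  conservative j a := by
    unfold op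
    split_ifs
    exacts [⟨0, rfl⟩, ⟨1, rfl⟩]
  closed _ hx := hS.ite_mem (hx 0) (hx 1)

theorem Closed.swap (hS : Closed X S) : Closed X {p | (p.1, !p.2) ∉ S} := by
  convert (hS.isAggregator_op.minor ![1, 0]).closed_literals using 1
  ext ⟨j, b⟩
  by_cases h : (j, !b) ∈ S <;> simp [literals, op, h]

theorem admitsNonDictatorial_two_iff_exists_closed (hX : Nondegenerate X) (j : Fin m) :
    AdmitsNonDictatorial X 2 ↔ ∃ S, Closed X S ∧ S ≠ Set.univ ∧ ∃ b, (j, b) ∈ S := by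
  constructor
  · rintro ⟨f, hf, hnd⟩
    rw [← hf.op_literals, hX.isDictatorialOn_op_iff, not_or, ← ne_eq, ← ne_eq,
      ← Set.nonempty_iff_ne_empty] at hnd
    obtain ⟨huniv, ⟨k, b⟩, hkb⟩ := hnd
    by_cases hj : ∃ b, (j, b) ∈ literals f
    · exact ⟨_, hf.closed_literals, huniv, hj⟩
    · refine ⟨_, hf.closed_literals.swap, fun h => ?_, true, fun h => hj ⟨_, h⟩⟩
      have hmem : (k, !b) ∈ {p : Literal m | (p.1, !p.2) ∉ literals f} := h ▸ Set.mem_univ _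
      exact hmem (by simpa using hkb)
  · rintro ⟨S, hS, huniv, b, hb⟩
    refine ⟨op S, hS.isAggregator_op, ?_⟩
    rw [hX.isDictatorialOn_op_iff, not_or]
    exact ⟨huniv, Set.nonempty_iff_ne_empty.1 ⟨_, hb⟩⟩

/-! ### Closing a set of literals by rounds -/

section Iteration

variable {α β : Type*} [PartialOrder β]

theorem le_foldl_of_inflationary {f : β → α → β} (hf : ∀ s x, s ≤ f s x) (l : List α) (s : β) :
    s ≤ l.foldl f s :=
  List.foldlRecOn l f le_rfl fun t ht x _ => ht.trans (hf t x)

theorem eq_of_foldl_eq_self {f : β → α → β} (hf : ∀ s x, s ≤ f s x) {l : List α} {s : β}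
    (h : l.foldl f s = s) : ∀ x ∈ l, f s x = s := by
  induction l with
  | nil => simp
  | cons y l ih =>
    have hy : f s y = s := le_antisymm ((le_foldl_of_inflationary hf l _).trans h.le) (hf s y)
    rw [List.foldl_cons, hy] at h
    simpa [hy] using ih h

end Iteration

theorem iterate_isFixedPt_of_rank {β : Type*} {F : β → β} {r : β → ℕ}
    (hr : ∀ s, F s ≠ s → r s < r (F s)) {n : ℕ} {s : β} (hn : ∀ k, r (F^[k] s) ≤ r s + n) :
    Function.IsFixedPt F (F^[n] s) := by
  induction n generalizing s with
  | zero => exact by_contra fun h => (hr s h).not_ge (hn 1)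
  | succ n ih =>
    by_cases hs : F s = s
    · rwa [Function.iterate_fixed hs]
    · exact ih fun k => (hn (k + 1)).trans (by have := hr s hs; omega)

/-- One round of the closure algorithm: adds the forced literals, for all pairs of elements of the
list in turn. -/
def round (rows : List (Evaluation m)) (S : Set (Literal m)) : Set (Literal m) :=
  rows.foldl (fun S z => rows.foldl (fun S z' => S ∪ forced {x | x ∈ rows} S z z') S) S

variable {rows : List (Evaluation m)}

theorem subset_round (S : Set (Literal m)) : S ⊆ round rows S :=
  le_foldl_of_inflationary
    (fun _ _ => le_foldl_of_inflationary (fun _ _ => Set.subset_union_left) _ _) _ _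

theorem closed_of_isFixedPt_round (h : Function.IsFixedPt (round rows) S) :
    Closed {x | x ∈ rows} S := by
  intro z hz z' hz'
  have hfold := eq_of_foldl_eq_self
    (fun _ _ => le_foldl_of_inflationary (fun _ _ => Set.subset_union_left) _ _) h z hz
  exact Set.union_eq_left.1 (eq_of_foldl_eq_self (fun _ _ => Set.subset_union_left) hfold z' hz')

theorem Closed.round_subset (hT : Closed {x | x ∈ rows} T) (hST : S ⊆ T) : round rows S ⊆ T :=
  List.foldlRecOn (motive := (· ⊆ T)) rows _ hST fun _ hS z hz =>
    List.foldlRecOn (motive := (· ⊆ T)) rows _ hS fun _ hS z' hz' =>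
      Set.union_subset hS ((forced_mono hS z z').trans (hT z hz z' hz'))

theorem closed_round_iterate (S : Set (Literal m)) {N : ℕ} (hN : 2 * m ≤ N) :
    Closed {x | x ∈ rows} ((round rows)^[N] S) := by
  refine closed_of_isFixedPt_round (iterate_isFixedPt_of_rank (r := Set.ncard) ?_ fun k => ?_)
  · exact fun S hS => Set.ncard_lt_ncard ((subset_round S).ssubset_of_ne (Ne.symm hS))
  · have hcard := Set.ncard_le_card ((round rows)^[k] S)
    rw [Nat.card_eq_fintype_card, Fintype.card_prod, Fintype.card_fin, Fintype.card_bool] at hcard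
    omega

theorem admitsNonDictatorial_two_iff_round [NeZero m] (hX : Nondegenerate {x | x ∈ rows}) {N : ℕ}
    (hN : 2 * m ≤ N) :
    AdmitsNonDictatorial {x | x ∈ rows} 2 ↔ ∃ u, (round rows)^[N] {(0, u)} ≠ Set.univ := by
  rw [admitsNonDictatorial_two_iff_exists_closed hX 0]
  constructor
  · rintro ⟨T, hT, huniv, u, hu⟩
    have hsub : (round rows)^[N] {(0, u)} ⊆ T :=
      Set.MapsTo.iterate (s := {S | S ⊆ T}) (fun _ => hT.round_subset) N
        (Set.singleton_subset_iff.2 hu)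
    exact ⟨u, fun h => huniv (Set.univ_subset_iff.1 (h ▸ hsub))⟩
  · rintro ⟨u, h⟩
    have hle : {(0, u)} ⊆ (round rows)^[N] {(0, u)} :=
      Function.id_le_iterate_of_id_le subset_round N _
    exact ⟨_, closed_round_iterate _ hN, h, u, hle rfl⟩

end Aggregation

/-! ### A language of row programs and its compilation to stack machines -/

/-- A program that acts on a state in `Q` and on one row of cells in `C`, and that reads the rows
of its input through iterators in `ι`. -/
inductive RowProgram (ι Q C : Type) : Type
  /-- Change the state by `u`. -/
  | assign (u : Q → Q)
  /-- Visit the cells in order, changing each one by `f` and then the state by `g`. -/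
  | sweep (f : Q → C → C) (g : Q → C → Q)
  /-- Run two programs in succession. -/
  | seq (p₁ p₂ : RowProgram ι Q C)
  /-- For each row of the input in turn, write it into the cells through `i` and run `p`. -/
  | each (i : ι) (p : RowProgram ι Q C)
  /-- Run `p` once for each symbol of the input word, counted off by `i`. -/
  | rounds (i : ι) (p : RowProgram ι Q C)

namespace RowProgram

open Turing Turing.TM2 Turing.TM2.Stmt

variable {ι α Q C Λ : Type} {m : ℕ}

/-- The input word that lists the given rows; `none` marks the end of a row. -/
def word (rows : List (Fin m → α)) : List (Option α) :=
  rows.flatMap fun x => (List.ofFn x).map some ++ [none]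

@[simp] theorem word_nil : word ([] : List (Fin m → α)) = [] := rfl

@[simp] theorem word_cons (x : Fin m → α) (rows : List (Fin m → α)) :
    word (x :: rows) = (List.ofFn x).map some ++ none :: word rows := by
  simp [word]

theorem length_word (rows : List (Fin m → α)) : (word rows).length = rows.length * (m + 1) := by
  simp [word, List.length_flatMap]

theorem length_le_length_word (rows : List (Fin m → α)) : rows.length ≤ (word rows).length := by
  rw [length_word]
  exact Nat.le_mul_of_pos_right _ m.succ_pos

/-- The effect of a sweep on a state and a row of cells. -/
def sweepRow (f : Q → C → C) (g : Q → C → Q) : {m : ℕ} → Q × (Fin m → C) → Q × (Fin m → C)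
  | 0, s => s
  | _ + 1, (q, c) =>
    let s := sweepRow f g (g q (c 0), Fin.tail c)
    (s.1, Fin.cons (f q (c 0)) s.2)

theorem sweepRow_of_fixed {f : Q → C → C} {g : Q → C → Q} {q : Q} (hg : ∀ c, g q c = q)
    (c : Fin m → C) : sweepRow f g (q, c) = (q, fun j => f q (c j)) := by
  induction m with
  | zero => exact Prod.ext rfl (Subsingleton.elim _ _)
  | succ m ih =>
    simp only [sweepRow, hg, ih, Prod.mk.injEq, true_and]
    exact Fin.cons_self_tail fun j => f q (c j)

/-- The effect of a program on a state and a row of cells, for a given list of input rows;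
`put i a c` is the cell `c` after the symbol `a` is written into it through the iterator `i`. -/
def den (put : ι → α → C → C) (rows : List (Fin m → α)) :
    RowProgram ι Q C → Q × (Fin m → C) → Q × (Fin m → C)
  | assign u, s => (u s.1, s.2)
  | sweep f g, s => sweepRow f g s
  | seq p₁ p₂, s => p₂.den put rows (p₁.den put rows s)
  | each i p, s => rows.foldl (fun s x => p.den put rows (s.1, fun j => put i (x j) (s.2 j))) s
  | rounds _ p, s => (p.den put rows)^[(word rows).length] s

theorem den_each_induction {put : ι → α → C → C} {rows : List (Fin m → α)} {i : ι}
    {p : RowProgram ι Q C} {motive : List (Fin m → α) → Q × (Fin m → C) → Prop}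
    {s : Q × (Fin m → C)} (nil : motive [] s)
    (concat : ∀ l x s, motive l s →
      motive (l ++ [x]) (p.den put rows (s.1, fun j => put i (x j) (s.2 j)))) :
    motive rows ((each i p).den put rows s) := by
  have hmotive : ∀ l : List (Fin m → α), motive l
      (l.foldl (fun s x => p.den put rows (s.1, fun j => put i (x j) (s.2 j))) s) := fun l => by
    induction l using List.reverseRecOn with
    | nil => exact nil
    | append_singleton l x ih =>
      rw [List.foldl_concat]
      exact concat l x _ ih
  exact hmotive rows

/-- The iterators that a program uses. -/
def iterators : RowProgram ι Q C → Set ι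
  | assign _ => ∅
  | sweep _ _ => ∅
  | seq p₁ p₂ => p₁.iterators ∪ p₂.iterators
  | each i p => insert i p.iterators
  | rounds i p => insert i p.iterators

/-- No loop uses the iterator of a loop around it. -/
def WellFormed : RowProgram ι Q C → Prop
  | assign _ => True
  | sweep _ _ => True
  | seq p₁ p₂ => p₁.WellFormed ∧ p₂.WellFormed
  | each i p => i ∉ p.iterators ∧ p.WellFormed
  | rounds i p => i ∉ p.iterators ∧ p.WellFormed

/-- A bound for the running time of a compiled program, in the length of the input word. -/
noncomputable def time : RowProgram ι Q C → Polynomial ℕ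
  | assign _ => 1
  | sweep _ _ => 2 * Polynomial.X + 2
  | seq p₁ p₂ => p₁.time + p₂.time
  | each _ p => Polynomial.X + 2 + Polynomial.X * (2 * Polynomial.X + 3 + p.time)
  | rounds _ p => Polynomial.X + 2 + Polynomial.X * (1 + p.time)

/-- The labels of a compiled sweep. -/
inductive SweepLabel : Type
  | forward | back
  deriving DecidableEq

instance : Fintype SweepLabel :=
  ⟨{.forward, .back}, by rintro ⟨⟩ <;> simp⟩

/-- The labels of a compiled loop over the rows, whose body has labels in `Λ`. -/
inductive EachLabel (Λ : Type) : Type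
  | rewind | test | row | back
  | body (l : Λ)
  deriving Fintype

/-- The labels of a compiled loop over the symbols, whose body has labels in `Λ`. -/
inductive RoundsLabel (Λ : Type) : Type
  | rewind | test
  | body (l : Λ)
  deriving Fintype

/-- The labels of a compiled program. -/
def Label : RowProgram ι Q C → Type
  | assign _ => Unit
  | sweep _ _ => SweepLabel
  | seq p₁ p₂ => p₁.Label ⊕ p₂.Label
  | each _ p => EachLabel p.Label
  | rounds _ p => RoundsLabel p.Label

instance Label.fintype : (p : RowProgram ι Q C) → Fintype p.Label
  | assign _ => inferInstanceAs (Fintype Unit)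
  | sweep _ _ => inferInstanceAs (Fintype SweepLabel)
  | seq p₁ p₂ =>
    have := Label.fintype p₁
    have := Label.fintype p₂
    inferInstanceAs (Fintype (p₁.Label ⊕ p₂.Label))
  | each _ p =>
    have := Label.fintype p
    inferInstanceAs (Fintype (EachLabel p.Label))
  | rounds _ p =>
    have := Label.fintype p
    inferInstanceAs (Fintype (RoundsLabel p.Label))

/-- The label at which a compiled program starts. -/
def entry : (p : RowProgram ι Q C) → p.Label
  | assign _ => ()
  | sweep _ _ => SweepLabel.forward
  | seq p₁ _ => Sum.inl p₁.entry
  | each _ _ => EachLabel.rewind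
  | rounds _ _ => RoundsLabel.rewind

/-- The stacks of the machine. The read part of an iterator is stored in reverse; so are the cells
to the left of the head, which is at the top of `right`. -/
inductive Stack (ι : Type) : Type
  | input | output | left | right
  | unread (i : ι)
  | read (i : ι)
  deriving DecidableEq, Fintype

/-- The alphabets of the stacks. -/
abbrev Alphabet (ι α C : Type) : Stack ι → Type
  | .input => Option α
  | .output => Bool
  | .left => C
  | .right => C
  | .unread _ => Option α
  | .read _ => Option α

/-- The register of the machine: the state of the program, and the results of the last lookups on
a stack of input symbols and on a stack of cells. -/
structure Register (α Q C : Type) : Type where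
  state : Q
  symbol : Option (Option α) := none
  cell : Option C := none
  deriving Fintype

/-- Forget the results of the last lookups. -/
def Register.clear (r : Register α Q C) : Register α Q C := { state := r.state }

/-- The contents of the stacks. -/
structure Tapes (ι α C : Type) : Type where
  input : List (Option α) := []
  output : List Bool := []
  left : List C := []
  right : List C := []
  unread : ι → List (Option α) := fun _ => []
  read : ι → List (Option α) := fun _ => []

namespace Tapes

/-- The contents of the stacks as a dependent function. -/
def contents (T : Tapes ι α C) : ∀ k : Stack ι, List (Alphabet ι α C k)
  | .input => T.input
  | .output => T.output
  | .left => T.left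
  | .right => T.right
  | .unread i => T.unread i
  | .read i => T.read i

variable (T : Tapes ι α C)

@[simp] theorem contents_input : T.contents .input = T.input := rfl
@[simp] theorem contents_output : T.contents .output = T.output := rfl
@[simp] theorem contents_left : T.contents .left = T.left := rfl
@[simp] theorem contents_right : T.contents .right = T.right := rfl
@[simp] theorem contents_unread (i : ι) : T.contents (.unread i) = T.unread i := rfl
@[simp] theorem contents_read (i : ι) : T.contents (.read i) = T.read i := rfl

variable [DecidableEq ι]

@[simp] theorem update_contents_input (x : List (Option α)) :
    Function.update T.contents .input x = { T with input := x }.contents := by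
  funext k; cases k <;> rfl

@[simp] theorem update_contents_output (x : List Bool) :
    Function.update T.contents .output x = { T with output := x }.contents := by
  funext k; cases k <;> rfl

@[simp] theorem update_contents_left (x : List C) :
    Function.update T.contents .left x = { T with left := x }.contents := by
  funext k; cases k <;> rfl

@[simp] theorem update_contents_right (x : List C) :
    Function.update T.contents .right x = { T with right := x }.contents := by
  funext k; cases k <;> rfl

@[simp] theorem update_contents_unread (i : ι) (x : List (Option α)) :
    Function.update T.contents (.unread i) x =
      { T with unread := Function.update T.unread i x }.contents := by
  funext k
  cases k with
  | unread j =>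
    rcases eq_or_ne j i with rfl | h
    · simp
    · simp [h]
  | _ => rfl

@[simp] theorem update_contents_read (i : ι) (x : List (Option α)) :
    Function.update T.contents (.read i) x =
      { T with read := Function.update T.read i x }.contents := by
  funext k
  cases k with
  | read j =>
    rcases eq_or_ne j i with rfl | h
    · simp
    · simp [h]
  | _ => rfl

end Tapes

section Code

variable [Inhabited C]

/-- Move the cells on the left back to the right, then go to `next`. -/
def returnStmt (self next : Λ) : Stmt (Alphabet ι α C) Λ (Register α Q C) :=
  pop .left (fun r c => { r with cell := c }) <|
  branch (fun r => r.cell.isSome)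
    (push .right (fun r => (r.cell.getD default : C)) <| load Register.clear <| goto fun _ => self)
    (goto fun _ => next)

/-- Move the symbols that `i` has read back to its unread symbols, then go to `next`. -/
def rewindStmt (i : ι) (self next : Λ) : Stmt (Alphabet ι α C) Λ (Register α Q C) :=
  pop (.read i) (fun r a => { r with symbol := a }) <|
  branch (fun r => r.symbol.isSome)
    (push (.unread i) (fun r => (r.symbol.join : Option α)) <| load Register.clear <|
      goto fun _ => self)
    (goto fun _ => next)

/-- Sweep over the cells on the right, then go to `next`. -/
def sweepStmt (f : Q → C → C) (g : Q → C → Q) (self next : Λ) :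
    Stmt (Alphabet ι α C) Λ (Register α Q C) :=
  pop .right (fun r c => { r with cell := c }) <|
  branch (fun r => r.cell.isSome)
    (push .left (fun r => (f r.state (r.cell.getD default) : C)) <|
      load (fun r => { state := g r.state (r.cell.getD default) }) <| goto fun _ => self)
    (goto fun _ => next)

/-- Go to `row` if `i` has an unread symbol, and to `next` otherwise. -/
def testStmt (i : ι) (row next : Λ) : Stmt (Alphabet ι α C) Λ (Register α Q C) :=
  peek (.unread i) (fun r a => { r with symbol := a }) <|
  branch (fun r => r.symbol.isSome) (load Register.clear <| goto fun _ => row) (goto fun _ => next)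

/-- Write the rest of the current row of `i` into the cells on the right, then go to `next`. -/
def rowStmt (put : ι → α → C → C) (i : ι) (self next : Λ) :
    Stmt (Alphabet ι α C) Λ (Register α Q C) :=
  pop (.unread i) (fun r a => { r with symbol := a }) <|
  push (.read i) (fun r => (r.symbol.join : Option α)) <|
  branch (fun r => r.symbol.join.isSome)
    (pop .right (fun r c => { r with cell := c }) <|
      push .left (fun r => (r.symbol.join.elim id (put i) (r.cell.getD default) : C)) <|
      load Register.clear <| goto fun _ => self)
    (load Register.clear <| goto fun _ => next)

/-- Read a symbol through `i` and go to `body`, or go to `next` if no symbol is left. -/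
def countStmt (i : ι) (body next : Λ) : Stmt (Alphabet ι α C) Λ (Register α Q C) :=
  pop (.unread i) (fun r a => { r with symbol := a }) <|
  branch (fun r => r.symbol.isSome)
    (push (.read i) (fun r => (r.symbol.join : Option α)) <| load Register.clear <|
      goto fun _ => body)
    (goto fun _ => next)

/-- The compiled program, with its labels embedded in `Λ` by `e`; at its end it goes to `after`. -/
def code (put : ι → α → C → C) : (p : RowProgram ι Q C) → (p.Label → Λ) → Λ → p.Label →
    Stmt (Alphabet ι α C) Λ (Register α Q C)
  | assign u, _, after, _ => load (fun r => { r with state := u r.state }) <| goto fun _ => after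
  | sweep f g, e, _, SweepLabel.forward => sweepStmt f g (e .forward) (e .back)
  | sweep _ _, e, after, SweepLabel.back => returnStmt (e .back) after
  | seq p₁ p₂, e, _, .inl l => p₁.code put (e ∘ .inl) (e (.inr p₂.entry)) l
  | seq _ p₂, e, after, .inr l => p₂.code put (e ∘ .inr) after l
  | each i _, e, _, EachLabel.rewind => rewindStmt i (e .rewind) (e .test)
  | each i _, e, after, EachLabel.test => testStmt i (e .row) after
  | each i _, e, _, EachLabel.row => rowStmt put i (e .row) (e .back)
  | each _ p, e, _, EachLabel.back => returnStmt (e .back) (e (.body p.entry))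
  | each _ p, e, _, EachLabel.body l => p.code put (e ∘ .body) (e .test) l
  | rounds i _, e, _, RoundsLabel.rewind => rewindStmt i (e .rewind) (e .test)
  | rounds i p, e, after, RoundsLabel.test => countStmt i (e (.body p.entry)) after
  | rounds _ p, e, _, RoundsLabel.body l => p.code put (e ∘ .body) (e .test) l

end Code

section Reachability

variable {K σ : Type} [DecidableEq K] {Γ : K → Type}

/-- The machine `M` gets from `c` to `c'` in at most `t` steps. -/
def ReachesIn (M : Λ → Stmt Γ Λ σ) (c c' : Cfg Γ Λ σ) (t : ℕ) : Prop :=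
  Nonempty (StateTransition.EvalsToInTime (step M) c (some c') t)

variable {M : Λ → Stmt Γ Λ σ} {c c₁ c₂ : Cfg Γ Λ σ} {s t : ℕ}

theorem ReachesIn.trans (h₁ : ReachesIn M c c₁ s) (h₂ : ReachesIn M c₁ c₂ t) :
    ReachesIn M c c₂ (t + s) :=
  ⟨.trans _ _ _ _ _ _ h₁.some h₂.some⟩

theorem ReachesIn.mono (h : ReachesIn M c c₁ s) (hst : s ≤ t) : ReachesIn M c c₁ t :=
  h.map fun h => { h with steps_le_m := h.steps_le_m.trans hst }

theorem ReachesIn.single {l : Λ} {v : σ} {S : ∀ k, List (Γ k)} (h : stepAux (M l) v S = c) :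
    ReachesIn M ⟨some l, v, S⟩ c 1 :=
  ⟨⟨1, congrArg some h⟩, le_rfl⟩

theorem ReachesIn.head {l : Λ} {v : σ} {S : ∀ k, List (Γ k)} (h : stepAux (M l) v S = c)
    (h' : ReachesIn M c c₁ t) : ReachesIn M ⟨some l, v, S⟩ c₁ (t + 1) :=
  (single h).trans h'

end Reachability

namespace Tapes

/-- The cells are `L`, in reverse, to the left of the head, and `R` to the right. -/
def cells (T : Tapes ι α C) (L R : List C) : Tapes ι α C := { T with left := L, right := R }

/-- The iterator `i` has the unread symbols `u`, and has read the symbols `d`, in reverse. -/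
def seek [DecidableEq ι] (T : Tapes ι α C) (i : ι) (u d : List (Option α)) : Tapes ι α C :=
  { T with unread := Function.update T.unread i u, read := Function.update T.read i d }

/-- The configuration at the label `l` in the state `q`, with no lookups. -/
def config (T : Tapes ι α C) (l : Option Λ) (q : Q) : Cfg (Alphabet ι α C) Λ (Register α Q C) :=
  ⟨l, { state := q }, T.contents⟩

/-- The configuration at the label `l` for a state and a row of cells, with the head on the left
of the row. -/
def standby (T : Tapes ι α C) (l : Λ) (s : Q × (Fin m → C)) :
    Cfg (Alphabet ι α C) Λ (Register α Q C) :=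
  (T.cells [] (List.ofFn s.2)).config (some l) s.1

end Tapes

section Loops

variable [DecidableEq ι] {M : Λ → Stmt (Alphabet ι α C) Λ (Register α Q C)} {l next : Λ}
  (T : Tapes ι α C)

theorem rewindStmt_reachesIn {i : ι} (hM : M l = rewindStmt i l next) (s : Q × (Fin m → C))
    (u d : List (Option α)) :
    ReachesIn M ((T.seek i u d).standby l s) ((T.seek i (d.reverse ++ u) []).standby next s)
      (d.length + 1) := by
  induction d generalizing u with
  | nil => exact .single (by
      simp [hM, rewindStmt, Tapes.standby, Tapes.config, Tapes.cells, Tapes.seek])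
  | cons a d ih =>
    refine .head (c := (T.seek i (a :: u) d).standby l s) ?_ ?_
    · simp [hM, rewindStmt, Tapes.standby, Tapes.config, Tapes.cells, Tapes.seek, Register.clear]
    · simpa using ih (a :: u)

variable [Inhabited C]

theorem returnStmt_reachesIn (hM : M l = returnStmt l next) (q : Q) (L R : List C) :
    ReachesIn M ((T.cells L R).config (some l) q)
      ((T.cells [] (L.reverse ++ R)).config (some next) q) (L.length + 1) := by
  induction L generalizing R with
  | nil => exact .single (by simp [hM, returnStmt, Tapes.config, Tapes.cells])
  | cons c L ih =>
    refine .head (c := (T.cells L (c :: R)).config (some l) q) ?_ ?_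
    · simp [hM, returnStmt, Tapes.config, Tapes.cells, Register.clear]
    · simpa using ih (c :: R)

theorem returnStmt_reachesIn_standby (hM : M l = returnStmt l next) (s : Q × (Fin m → C)) :
    ReachesIn M ((T.cells (List.ofFn s.2).reverse []).config (some l) s.1) (T.standby next s)
      (m + 1) := by
  simpa [Tapes.standby] using returnStmt_reachesIn T hM s.1 (List.ofFn s.2).reverse []

theorem sweepStmt_reachesIn {f : Q → C → C} {g : Q → C → Q} (hM : M l = sweepStmt f g l next)
    (L : List C) (s : Q × (Fin m → C)) :
    ReachesIn M ((T.cells L (List.ofFn s.2)).config (some l) s.1)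
      ((T.cells ((List.ofFn (sweepRow f g s).2).reverse ++ L) []).config (some next)
        (sweepRow f g s).1) (m + 1) := by
  induction m generalizing L with
  | zero => exact .single (by simp [hM, sweepStmt, Tapes.config, Tapes.cells, sweepRow])
  | succ m ih =>
    obtain ⟨q, c⟩ := s
    refine .head (c := (T.cells (f q (c 0) :: L) (List.ofFn (Fin.tail c))).config (some l)
      (g q (c 0))) ?_ ?_
    · simp [hM, sweepStmt, Tapes.config, Tapes.cells, Fin.tail_def]
    · simpa [sweepRow] using ih (f q (c 0) :: L) (g q (c 0), Fin.tail c)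

theorem rowStmt_reachesIn {put : ι → α → C → C} {i : ι} (hM : M l = rowStmt put i l next)
    (u d : List (Option α)) (x : Fin m → α) (q : Q) (L : List C) (c : Fin m → C) :
    ReachesIn M
      (((T.seek i ((List.ofFn x).map some ++ none :: u) d).cells L (List.ofFn c)).config
        (some l) q)
      (((T.seek i u (none :: ((List.ofFn x).map some).reverse ++ d)).cells
        ((List.ofFn fun j => put i (x j) (c j)).reverse ++ L) []).config (some next) q)
      (m + 1) := by
  induction m generalizing d L with
  | zero => exact .single (by
      simp [hM, rowStmt, Tapes.config, Tapes.cells, Tapes.seek, Register.clear])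
  | succ m ih =>
    refine .head (c := ((T.seek i ((List.ofFn (Fin.tail x)).map some ++ none :: u)
      (some (x 0) :: d)).cells (put i (x 0) (c 0) :: L) (List.ofFn (Fin.tail c))).config
        (some l) q) ?_ ?_
    · simp [hM, rowStmt, Tapes.config, Tapes.cells, Tapes.seek, Fin.tail_def, Register.clear]
    · simpa [Fin.tail_def] using ih (some (x 0) :: d) (Fin.tail x)
        (put i (x 0) (c 0) :: L) (Fin.tail c)

end Loops

/-- The iterators in `S` have read all of the word `w`. -/
def Tapes.Spent (T : Tapes ι α C) (S : Set ι) (w : List (Option α)) : Prop :=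
  ∀ i ∈ S, T.unread i = [] ∧ T.read i = w.reverse

section Spent

variable [DecidableEq ι] {T : Tapes ι α C} {S : Set ι} {w : List (Option α)} {i : ι}

theorem Tapes.Spent.seek (h : T.Spent S w) (hi : i ∉ S) (u d : List (Option α)) :
    (T.seek i u d).Spent S w := fun j hj => by
  have hji : j ≠ i := ne_of_mem_of_not_mem hj hi
  simpa [Tapes.seek, hji] using h j hj

theorem Tapes.Spent.seek_eq_self (h : T.Spent S w) (hi : i ∈ S) : T.seek i [] w.reverse = T := by
  simp [Tapes.seek, ← (h i hi).1, ← (h i hi).2]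

end Spent

/-- Started at `start` on a row of cells, with all iterators of `p` spent, the machine runs `p`
within its time bound and gets to `after`, with the iterators in the same position. -/
def Implements [DecidableEq ι] (M : Λ → Stmt (Alphabet ι α C) Λ (Register α Q C))
    (put : ι → α → C → C) (rows : List (Fin m → α)) (p : RowProgram ι Q C) (start after : Λ) :
    Prop :=
  ∀ (T : Tapes ι α C) (s : Q × (Fin m → C)), T.Spent p.iterators (word rows) →
    ReachesIn M (T.standby start s) (T.standby after (p.den put rows s))
      (p.time.eval (word rows).length)

section Implements

variable [DecidableEq ι] {M : Λ → Stmt (Alphabet ι α C) Λ (Register α Q C)}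
  {put : ι → α → C → C} {rows : List (Fin m → α)} {p p₁ p₂ : RowProgram ι Q C} {i : ι}
  {start mid test row back body after : Λ}

theorem implements_assign {u : Q → Q}
    (hM : M start = (load (fun r => { r with state := u r.state }) <| goto fun _ => after)) :
    Implements M put rows (assign u) start after := fun T s _ =>
  (ReachesIn.single (by simp [hM, Tapes.config, Tapes.standby, den])).mono (by simp [time])

theorem Implements.seq (h₁ : Implements M put rows p₁ start mid)
    (h₂ : Implements M put rows p₂ mid after) :
    Implements M put rows (seq p₁ p₂) start after := fun T s hT => by
  have h := (h₁ T s fun i hi => hT i (.inl hi)).trans (h₂ T _ fun i hi => hT i (.inr hi))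
  exact h.mono (by simp [time, add_comm])

theorem Implements.rounds_loop (hM : M test = countStmt i body after)
    (hp : Implements M put rows p body test) (hi : i ∉ p.iterators) {T : Tapes ι α C}
    (hT : T.Spent p.iterators (word rows)) (u d : List (Option α)) (s : Q × (Fin m → C)) :
    ReachesIn M ((T.seek i u d).standby test s)
      ((T.seek i [] (u.reverse ++ d)).standby after ((p.den put rows)^[u.length] s))
      (u.length * (1 + p.time.eval (word rows).length) + 1) := by
  induction u generalizing d s with
  | nil => exact (ReachesIn.single (by
      simp [hM, countStmt, Tapes.standby, Tapes.config, Tapes.cells, Tapes.seek])).mono (by simp)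
  | cons a u ih =>
    have hread : ReachesIn M ((T.seek i (a :: u) d).standby test s)
        ((T.seek i u (a :: d)).standby body s) 1 := .single (by
      simp [hM, countStmt, Tapes.standby, Tapes.config, Tapes.cells, Tapes.seek, Register.clear])
    have hbody := hp (T.seek i u (a :: d)) s (hT.seek hi _ _)
    have h := (hread.trans hbody).trans (ih (a :: d) (p.den put rows s))
    simp only [List.reverse_cons, List.append_assoc, List.cons_append, List.nil_append,
      List.length_cons, Function.iterate_succ_apply]
    exact h.mono (by rw [Nat.succ_mul]; omega)

theorem Implements.rounds (hrewind : M start = rewindStmt i start test)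
    (htest : M test = countStmt i body after) (hp : Implements M put rows p body test)
    (hi : i ∉ p.iterators) : Implements M put rows (rounds i p) start after := fun T s hT => by
  have hrewind := rewindStmt_reachesIn T hrewind s [] (word rows).reverse
  have hloop := hp.rounds_loop htest hi (fun j hj => hT j (.inr hj)) (word rows) [] s
  simp only [List.reverse_reverse, List.append_nil, hT.seek_eq_self (.inl rfl)] at hrewind hloop
  refine (hrewind.trans hloop).mono ?_
  simp only [time, List.length_reverse, Polynomial.eval_add, Polynomial.eval_mul,
    Polynomial.eval_ofNat, Polynomial.eval_one, Polynomial.eval_X]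
  omega

variable [Inhabited C]

theorem implements_sweep {f : Q → C → C} {g : Q → C → Q} (hm : m ≤ (word rows).length)
    (hforward : M start = sweepStmt f g start back) (hback : M back = returnStmt back after) :
    Implements M put rows (sweep f g) start after := fun T s _ => by
  have hforward := sweepStmt_reachesIn T hforward [] s
  rw [List.append_nil] at hforward
  have h := hforward.trans (returnStmt_reachesIn_standby T hback (sweepRow f g s))
  refine h.mono ?_
  simp only [time, Polynomial.eval_add, Polynomial.eval_mul, Polynomial.eval_ofNat,
    Polynomial.eval_X]
  omega

theorem Implements.each_loop (htest : M test = testStmt i row after)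
    (hrow : M row = rowStmt put i row back) (hback : M back = returnStmt back body)
    (hp : Implements M put rows p body test) (hi : i ∉ p.iterators) {T : Tapes ι α C}
    (hT : T.Spent p.iterators (word rows)) (xs : List (Fin m → α)) (d : List (Option α))
    (s : Q × (Fin m → C)) :
    ReachesIn M ((T.seek i (word xs) d).standby test s)
      ((T.seek i [] ((word xs).reverse ++ d)).standby after
        (xs.foldl (fun s x => p.den put rows (s.1, fun j => put i (x j) (s.2 j))) s))
      (xs.length * (2 * m + 3 + p.time.eval (word rows).length) + 1) := by
  induction xs generalizing d s with
  | nil => exact (ReachesIn.single (by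
      simp [htest, testStmt, Tapes.standby, Tapes.config, Tapes.cells, Tapes.seek])).mono (by simp)
  | cons x xs ih =>
    obtain ⟨q, c⟩ := s
    have htest : ReachesIn M ((T.seek i (word (x :: xs)) d).standby test (q, c))
        ((T.seek i (word (x :: xs)) d).standby row (q, c)) 1 := .single (by
      cases m <;>
        simp [htest, testStmt, Tapes.standby, Tapes.config, Tapes.cells, Tapes.seek,
          Register.clear])
    have hrow := rowStmt_reachesIn T hrow (word xs) d x q [] c
    set d' := none :: ((List.ofFn x).map some).reverse ++ d with hd'
    rw [List.append_nil, ← word_cons] at hrow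
    have hback := returnStmt_reachesIn_standby (T.seek i (word xs) d') hback
      (q, fun j => put i (x j) (c j))
    have hbody := hp (T.seek i (word xs) d') (q, fun j => put i (x j) (c j)) (hT.seek hi _ _)
    have h := (((htest.trans hrow).trans hback).trans hbody).trans (ih d' _)
    have hd : (word (x :: xs)).reverse ++ d = (word xs).reverse ++ d' := by simp [hd']
    rw [hd]
    exact h.mono (by rw [List.length_cons, Nat.succ_mul xs.length]; omega)

theorem Implements.each (hm : m ≤ (word rows).length) (hrewind : M start = rewindStmt i start test)
    (htest : M test = testStmt i row after) (hrow : M row = rowStmt put i row back)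
    (hback : M back = returnStmt back body) (hp : Implements M put rows p body test)
    (hi : i ∉ p.iterators) : Implements M put rows (each i p) start after := fun T s hT => by
  have hrewind := rewindStmt_reachesIn T hrewind s [] (word rows).reverse
  have hloop := hp.each_loop htest hrow hback hi (fun j hj => hT j (.inr hj)) rows [] s
  simp only [List.reverse_reverse, List.append_nil, hT.seek_eq_self (.inl rfl)] at hrewind hloop
  refine (hrewind.trans hloop).mono ?_
  have hrounds : rows.length * (2 * m + 3 + p.time.eval (word rows).length) ≤
      (word rows).length * (2 * (word rows).length + 3 + p.time.eval (word rows).length) := by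
    gcongr
    exact length_le_length_word rows
  simp only [time, List.length_reverse, Polynomial.eval_add, Polynomial.eval_mul,
    Polynomial.eval_ofNat, Polynomial.eval_X]
  omega

theorem implements_code (hm : m ≤ (word rows).length) (p : RowProgram ι Q C) (hp : p.WellFormed)
    (e : p.Label → Λ) (after : Λ) (hM : ∀ l, M (e l) = p.code put e after l) :
    Implements M put rows p (e p.entry) after := by
  induction p generalizing after with
  | assign u => exact implements_assign (hM ())
  | sweep f g => exact implements_sweep hm (hM .forward) (hM .back)
  | seq p₁ p₂ ih₁ ih₂ =>
    exact (ih₁ hp.1 _ _ fun l => hM (.inl l)).seq (ih₂ hp.2 _ after fun l => hM (.inr l))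
  | each i p ih =>
    exact (ih hp.2 _ _ fun l => hM (.body l)).each hm (hM .rewind) (hM .test) (hM .row)
      (hM .back) hp.1
  | rounds i p ih =>
    exact (ih hp.2 _ _ fun l => hM (.body l)).rounds (hM .rewind) (hM .test) hp.1

end Implements

/-- The labels of the machine of a program whose labels are in `Λ`: it first copies the input to
the iterators and writes a row of default cells, and at the end it clears the stacks. -/
inductive MainLabel (Λ : Type) : Type
  | copyFirst | copyRest | clear
  | program (l : Λ)
  deriving Fintype

section Main

variable [DecidableEq ι] [Fintype ι]

/-- Do `op i` for all iterators `i`, then `next`. -/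
noncomputable def forAll (op : ι → Stmt (Alphabet ι α C) Λ (Register α Q C) →
    Stmt (Alphabet ι α C) Λ (Register α Q C)) (next : Stmt (Alphabet ι α C) Λ (Register α Q C)) :
    Stmt (Alphabet ι α C) Λ (Register α Q C) :=
  Finset.univ.toList.foldr op next

theorem stepAux_forAll {op : ι → Stmt (Alphabet ι α C) Λ (Register α Q C) →
      Stmt (Alphabet ι α C) Λ (Register α Q C)}
    {F : List (Option α) → List (Option α)} {v : Register α Q C}
    (h : ∀ i next (T : Tapes ι α C), stepAux (op i next) v T.contents =
      stepAux next v { T with read := Function.update T.read i (F (T.read i)) }.contents)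
    (next : Stmt (Alphabet ι α C) Λ (Register α Q C)) (T : Tapes ι α C) :
    stepAux (forAll op next) v T.contents =
      stepAux next v { T with read := fun i => F (T.read i) }.contents := by
  have hfoldr : ∀ (is : List ι) (T : Tapes ι α C), is.Nodup →
      stepAux (is.foldr op next) v T.contents =
        stepAux next v
          { T with read := fun i => if i ∈ is then F (T.read i) else T.read i }.contents := by
    intro is
    induction is with
    | nil => simp
    | cons i is ih =>
      intro T his
      rw [List.foldr_cons, h, ih _ his.of_cons]
      congr 3
      funext j
      rcases eq_or_ne j i with rfl | hj
      · simp [(List.nodup_cons.1 his).1]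
      · simp [hj]
  simpa [forAll] using hfoldr Finset.univ.toList T (Finset.nodup_toList _)

/-- Push the symbol looked up last on the read part of all iterators. -/
noncomputable def pushAll (next : Stmt (Alphabet ι α C) Λ (Register α Q C)) :
    Stmt (Alphabet ι α C) Λ (Register α Q C) :=
  forAll (fun i => push (.read i) fun r => (r.symbol.join : Option α)) next

/-- Pop a symbol from the read part of all iterators. -/
noncomputable def popAll (next : Stmt (Alphabet ι α C) Λ (Register α Q C)) :
    Stmt (Alphabet ι α C) Λ (Register α Q C) :=
  forAll (fun i => pop (.read i) fun r _ => r) next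

variable (next : Stmt (Alphabet ι α C) Λ (Register α Q C)) (v : Register α Q C) (T : Tapes ι α C)

@[simp] theorem stepAux_pushAll : stepAux (pushAll next) v T.contents =
    stepAux next v { T with read := fun i => v.symbol.join :: T.read i }.contents :=
  stepAux_forAll (by simp) next T

@[simp] theorem stepAux_popAll : stepAux (popAll next) v T.contents =
    stepAux next v { T with read := fun i => (T.read i).tail }.contents :=
  stepAux_forAll (by simp) next T

variable [Inhabited ι] [Inhabited C]

/-- The statements of the machine of a program with initial state `q₀`. -/
noncomputable def mainCode (put : ι → α → C → C) (p : RowProgram ι Q C) (q₀ : Q)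
    (answer : Q → Bool) : MainLabel p.Label →
    Stmt (Alphabet ι α C) (MainLabel p.Label) (Register α Q C)
  | .copyFirst =>
      pop .input (fun r a => { r with symbol := a }) <| pushAll <|
      branch (fun r => r.symbol.join.isSome)
        (push .right (fun _ => (default : C)) <| load Register.clear <| goto fun _ => .copyFirst)
        (load Register.clear <| goto fun _ => .copyRest)
  | .copyRest =>
      pop .input (fun r a => { r with symbol := a }) <|
      branch (fun r => r.symbol.isSome)
        (pushAll <| load Register.clear <| goto fun _ => .copyRest)
        (goto fun _ => .program p.entry)
  | .clear =>
      peek (.read default) (fun r a => { r with symbol := a }) <| popAll <|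
      pop .right (fun r _ => r) <|
      branch (fun r => r.symbol.isSome)
        (load Register.clear <| goto fun _ => .clear)
        (push .output (fun r => answer r.state) <| load (fun _ => { state := q₀ }) halt)
  | .program l => p.code put .program .clear l

variable {put : ι → α → C → C} {p : RowProgram ι Q C} {q₀ : Q} {answer : Q → Bool}

theorem copyFirst_reachesIn (x : Fin m → α) (rest d : List (Option α)) (q : Q) (R : List C) :
    ReachesIn (mainCode put p q₀ answer)
      (Tapes.config
        { input := (List.ofFn x).map some ++ none :: rest
          right := R
          read := fun _ => d } (some .copyFirst) q)
      (Tapes.config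
        { input := rest
          right := List.replicate m default ++ R
          read := fun _ => none :: ((List.ofFn x).map some).reverse ++ d } (some .copyRest) q)
      (m + 1) := by
  induction m generalizing d R with
  | zero => exact .single (by simp [mainCode, Tapes.config, Register.clear])
  | succ m ih =>
    refine .head (c := Tapes.config
      { input := (List.ofFn (Fin.tail x)).map some ++ none :: rest
        right := default :: R
        read := fun _ => some (x 0) :: d } (some .copyFirst) q) ?_ ?_
    · simp [mainCode, Tapes.config, Register.clear, Fin.tail_def]
    · simpa [Fin.tail_def, List.replicate_succ'] using
        ih (Fin.tail x) (some (x 0) :: d) (default :: R)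

theorem copyRest_reachesIn (w d : List (Option α)) (q : Q) (R : List C) :
    ReachesIn (mainCode put p q₀ answer)
      (Tapes.config { input := w, right := R, read := fun _ => d } (some .copyRest) q)
      (Tapes.config { right := R, read := fun _ => w.reverse ++ d } (some (.program p.entry)) q)
      (w.length + 1) := by
  induction w generalizing d with
  | nil => exact .single (by simp [mainCode, Tapes.config])
  | cons a w ih =>
    refine .head (c := Tapes.config { input := w, right := R, read := fun _ => a :: d }
      (some .copyRest) q) ?_ ?_
    · simp [mainCode, Tapes.config, Register.clear]
    · simpa using ih (a :: d)

theorem copy_reachesIn (x : Fin m → α) (rows : List (Fin m → α)) (q : Q) :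
    ReachesIn (mainCode put p q₀ answer)
      (Tapes.config { input := word (x :: rows) } (some .copyFirst) q)
      (Tapes.standby { read := fun _ => (word (x :: rows)).reverse } (.program p.entry)
        (q, fun _ : Fin m => default)) ((word (x :: rows)).length + 1) := by
  have h := (copyFirst_reachesIn (put := put) (p := p) (q₀ := q₀) (answer := answer) x (word rows)
    [] q []).trans (copyRest_reachesIn (word rows) _ q _)
  simpa [Tapes.standby, Tapes.cells, List.ofFn_const, add_comm, add_left_comm, add_assoc] using h

theorem clear_reachesIn (q : Q) (d : List (Option α)) (R : List C) (hR : R.length ≤ d.length) :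
    ReachesIn (mainCode put p q₀ answer)
      (Tapes.config { right := R, read := fun _ => d } (some .clear) q)
      (Tapes.config { output := [answer q] } none q₀) (d.length + 1) := by
  induction d generalizing R with
  | nil =>
    obtain rfl := List.length_eq_zero_iff.1 (Nat.le_zero.1 hR)
    exact .single (by simp [mainCode, Tapes.config])
  | cons a d ih =>
    refine .head (c := Tapes.config { right := R.tail, read := fun _ => d } (some .clear) q) ?_
      (ih R.tail ?_)
    · simp [mainCode, Tapes.config, Register.clear]
    · simpa using hR

theorem mainCode_reachesIn (hp : p.WellFormed) {rows : List (Fin m → α)} (hrows : rows ≠ []) :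
    ReachesIn (mainCode put p q₀ answer)
      (Tapes.config { input := word rows } (some .copyFirst) q₀)
      (Tapes.config { output := [answer (p.den put rows (q₀, fun _ => default)).1] } none q₀)
      ((2 * Polynomial.X + 2 + p.time).eval (word rows).length) := by
  obtain ⟨x, rows, rfl⟩ := List.exists_cons_of_ne_nil hrows
  have hm : m ≤ (word (x :: rows)).length := by
    rw [word_cons]
    simp
  have hcopy := copy_reachesIn (put := put) (p := p) (q₀ := q₀) (answer := answer) x rows q₀
  have hrun := implements_code (M := mainCode put p q₀ answer) (put := put) hm p hp
    MainLabel.program .clear (fun _ => rfl) { read := fun _ => (word (x :: rows)).reverse }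
    (q₀, fun _ => default) (fun _ _ => ⟨rfl, rfl⟩)
  set s := p.den put (x :: rows) (q₀, fun _ => default)
  have hclear := clear_reachesIn (put := put) (p := p) (q₀ := q₀) (answer := answer) s.1
    (word (x :: rows)).reverse (List.ofFn s.2)
    (by rwa [List.length_reverse, List.length_ofFn])
  refine ((hcopy.trans hrun).trans hclear).mono (le_of_eq ?_)
  simp only [List.length_reverse, Polynomial.eval_add, Polynomial.eval_mul, Polynomial.eval_ofNat,
    Polynomial.eval_X]
  ring

variable [Fintype α] [Fintype Q] [Fintype C]

/-- The stack machine of a program with initial state `q₀`. -/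
noncomputable def machine (put : ι → α → C → C) (p : RowProgram ι Q C) (q₀ : Q)
    (answer : Q → Bool) : FinTM2 where
  K := Stack ι
  k₀ := .input
  k₁ := .output
  Γ := Alphabet ι α C
  Λ := MainLabel p.Label
  main := .copyFirst
  σ := Register α Q C
  initialState := { state := q₀ }
  Γk₀Fin := inferInstanceAs (Fintype (Option α))
  m := mainCode put p q₀ answer

theorem initList_machine (w : List (Option α)) : initList (machine put p q₀ answer) w =
    Tapes.config (Λ := MainLabel p.Label) { input := w } (some .copyFirst) q₀ := by
  unfold initList Tapes.config
  congr 1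
  funext k
  cases k <;> rfl

theorem haltList_machine (w : List Bool) : haltList (machine put p q₀ answer) w =
    Tapes.config (Λ := MainLabel p.Label) { output := w } none q₀ := by
  unfold haltList Tapes.config
  congr 1
  funext k
  cases k <;> rfl

theorem machine_outputsInTime (hp : p.WellFormed) {rows : List (Fin m → α)} (hrows : rows ≠ []) :
    Nonempty (TM2OutputsInTime (machine put p q₀ answer) (word rows)
      (some [answer (p.den put rows (q₀, fun _ => default)).1])
      ((2 * Polynomial.X + 2 + p.time).eval (word rows).length)) := by
  have h := mainCode_reachesIn (put := put) (q₀ := q₀) (answer := answer) hp hrows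
  rw [← initList_machine, ← haltList_machine] at h
  exact h

end Main

end RowProgram

namespace Aggregation

open RowProgram

/-! ### The decision procedure as a row program -/

/-- The flags of the decision procedure: the outcome of the last test, whether the row searched for
was found, and the answer so far. -/
structure Flags : Type where
  ok : Bool
  found : Bool
  answer : Bool
  deriving Fintype

/-- The cell of an issue: the entries of the four current rows, the literals of the issue in the
current set of literals, and whether an admissible row has been found to change the issue. -/
structure Cell : Type where
  row : Fin 4 → Bool
  lit : Bool → Bool
  hit : Bool
  deriving Fintype, Inhabited

/-- Write an entry of the row with number `i`. -/
def Cell.put (i : Fin 4) (b : Bool) (c : Cell) : Cell :=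
  { c with row := Function.update c.row i b }

/-- A row program of the decision procedure. -/
abbrev Procedure : Type := RowProgram (Fin 4) Flags Cell

namespace Procedure

/-- Update all cells. -/
def update (f : Flags → Cell → Cell) : Procedure := .sweep f fun q _ => q

/-- Let `ok` say whether all cells pass the test `t`. -/
def test (t : Cell → Bool) : Procedure :=
  .seq (.assign fun q => { q with ok := true }) <|
  .sweep (fun _ c => c) fun q c => { q with ok := q.ok && t c }

/-- Start with one literal of the first issue; `ok` says whether the head is on this issue. -/
def start (u : Bool) : Procedure :=
  .seq (.assign fun q => { q with ok := true }) <|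
  .sweep (fun q c => { c with lit := fun b => q.ok && b == u }) fun q _ => { q with ok := false }

/-- Mark the issues on which row `2`, if admissible for the rows `0` and `1`, differs from
row `0`. -/
def markHits : Procedure :=
  .seq (test fun c => !(c.row 0 == c.row 1 || c.lit (c.row 0)) || c.row 2 == c.row 0) <|
  update fun q c => { c with hit := c.hit || (q.ok && c.row 2 != c.row 0) }

/-- Add the literals forced by the rows `0` and `1`. -/
def extend : Procedure :=
  .seq (update fun _ c => { c with hit := false }) <|
  .seq (.each 2 markHits) <|
  update fun _ c => { c with lit := fun b => c.lit b || (c.row 0 == b && c.row 1 != b && !c.hit) }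

/-- Close one literal of the first issue, and answer `true` if the result is not full. -/
def closure (u : Bool) : Procedure :=
  .seq (start u) <|
  .seq (.rounds 3 (.each 0 (.each 1 extend))) <|
  .seq (test fun c => c.lit true && c.lit false) <|
  .assign fun q => { q with answer := q.answer || !q.ok }

/-- Set `found` if row `3` is the sum of the rows `0`, `1`, `2`. -/
def compareSum : Procedure :=
  .seq (test fun c => c.row 3 == xor (xor (c.row 0) (c.row 1)) (c.row 2)) <|
  .assign fun q => { q with found := q.found || q.ok }

/-- Answer `false` if the sum of the rows `0`, `1`, `2` is not in the list. -/
def testSum : Procedure :=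
  .seq (.assign fun q => { q with found := false }) <|
  .seq (.each 3 compareSum) <|
  .assign fun q => { q with answer := q.answer && q.found }

/-- The decision procedure; it is to be started with the answer `true`. -/
def decision : Procedure :=
  .seq (.each 0 (.each 1 (.each 2 testSum))) <| .seq (closure true) (closure false)

theorem decision_wellFormed : decision.WellFormed := by
  simp [decision, closure, start, extend, markHits, testSum, compareSum,
    update, test, WellFormed, iterators]

end Procedure

/-- The states of a procedure: flags, and a cell for each issue. -/
abbrev State (m : ℕ) : Type := Flags × (Fin m → Cell)

namespace State

variable {m : ℕ}

/-- The current row with number `i`. -/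
def row (s : State m) (i : Fin 4) : Evaluation m := fun j => (s.2 j).row i

/-- The current set of literals. -/
def literals (s : State m) : Set (Literal m) := {p | (s.2 p.1).lit p.2 = true}

/-- The issues marked so far. -/
def hits (s : State m) : Set (Fin m) := {j | (s.2 j).hit = true}

/-- Write the row with number `i`. -/
def write (s : State m) (i : Fin 4) (x : Evaluation m) : State m :=
  (s.1, fun j => (s.2 j).put i (x j))

variable (s : State m) (i k : Fin 4) (x : Evaluation m)

@[simp] theorem fst_write : (s.write i x).1 = s.1 := rfl

@[simp] theorem literals_write : (s.write i x).literals = s.literals := rfl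

@[simp] theorem hits_write : (s.write i x).hits = s.hits := rfl

@[simp] theorem row_write_self : (s.write i x).row i = x := by
  funext j
  simp [row, write, Cell.put]

variable {i k} in
@[simp] theorem row_write_of_ne (h : k ≠ i) : (s.write i x).row k = s.row k := by
  funext j
  simp [row, write, Cell.put, h]

theorem literals_eq_univ_iff :
    s.literals = Set.univ ↔ ∀ j, ((s.2 j).lit true && (s.2 j).lit false) = true := by
  simp [Set.eq_univ_iff_forall, literals, Prod.forall, Bool.forall_bool, and_comm]

end State

section Effect

variable {m : ℕ} (rows : List (Evaluation m))

/-- The effect of a procedure on a state, for a list of evaluations. -/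
abbrev effect (p : Procedure) : State m → State m := p.den Cell.put rows

theorem effect_seq (p p' : Procedure) (s : State m) :
    effect rows (.seq p p') s = effect rows p' (effect rows p s) := rfl

theorem effect_assign (u : Flags → Flags) (s : State m) :
    effect rows (.assign u) s = (u s.1, s.2) := rfl

theorem effect_update (f : Flags → Cell → Cell) (s : State m) :
    effect rows (Procedure.update f) s = (s.1, fun j => f s.1 (s.2 j)) :=
  sweepRow_of_fixed (fun _ => rfl) s.2

theorem effect_test (t : Cell → Bool) (s : State m) :
    effect rows (Procedure.test t) s =
      ({ s.1 with ok := decide (∀ j, t (s.2 j) = true) }, s.2) := by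
  have hsweep : ∀ {m : ℕ} (q : Flags) (c : Fin m → Cell),
      sweepRow (fun _ c => c) (fun q c => { q with ok := q.ok && t c }) (q, c) =
        ({ q with ok := q.ok && decide (∀ j, t (c j) = true) }, c) := by
    intro m
    induction m with
    | zero => exact fun q c => Prod.ext (by simp [sweepRow]) (Subsingleton.elim _ _)
    | succ m ih =>
      intro q c
      simp only [sweepRow, ih, Fin.cons_self_tail, Fin.forall_fin_succ, Bool.decide_and,
        Bool.decide_eq_true, Bool.and_assoc]
      rfl
  simpa [effect, Procedure.test, den] using hsweep { s.1 with ok := true } s.2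

variable {rows} {s : State m}

theorem effect_each_induction {i : Fin 4} {p : Procedure}
    {motive : List (Evaluation m) → State m → Prop} (nil : motive [] s)
    (concat : ∀ l x s, motive l s → motive (l ++ [x]) (effect rows p (s.write i x))) :
    motive rows (effect rows (.each i p) s) :=
  den_each_induction nil concat

theorem effect_start [NeZero m] (u : Bool) :
    (effect rows (Procedure.start u) s).1.answer = s.1.answer ∧
      (effect rows (Procedure.start u) s).literals = {(0, u)} := by
  obtain ⟨m, rfl⟩ := Nat.exists_eq_succ_of_ne_zero (NeZero.ne m)
  have hstart : effect rows (Procedure.start u) s = ({ s.1 with ok := false },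
      Fin.cons { s.2 0 with lit := fun b => b == u }
        fun j => { s.2 j.succ with lit := fun _ => false }) := by
    simp only [effect, Procedure.start, den, sweepRow]
    rw [sweepRow_of_fixed fun _ => rfl]
    simp [Fin.tail]
  rw [hstart]
  refine ⟨rfl, Set.ext fun ⟨j, b⟩ => ?_⟩
  refine Fin.cases ?_ (fun j => ?_) j <;> simp [State.literals]

theorem effect_markHits :
    (effect rows Procedure.markHits s).1.answer = s.1.answer ∧
      (effect rows Procedure.markHits s).literals = s.literals ∧
      (effect rows Procedure.markHits s).row = s.row ∧
      (effect rows Procedure.markHits s).hits = s.hits ∪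
        {j | Admissible s.literals (s.row 0) (s.row 1) (s.row 2) ∧ s.row 2 j ≠ s.row 0 j} := by
  have htest : (∀ j, (!((s.2 j).row 0 == (s.2 j).row 1 || (s.2 j).lit ((s.2 j).row 0)) ||
      (s.2 j).row 2 == (s.2 j).row 0) = true) ↔
      Admissible s.literals (s.row 0) (s.row 1) (s.row 2) :=
    forall_congr' fun j => by simp [State.row, State.literals, imp_iff_not_or]
  simp only [Procedure.markHits, effect_seq, effect_test, effect_update]
  refine ⟨by trivial, by trivial, by trivial, Set.ext fun j => ?_⟩
  rw [State.hits, Set.mem_ofPred_eq, Bool.or_eq_true, Bool.and_eq_true, decide_eq_true_eq, htest,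
    bne_iff_ne]
  rfl

theorem effect_each_markHits (hs : s.hits = ∅) :
    (effect rows (.each 2 Procedure.markHits) s).1.answer = s.1.answer ∧
      (effect rows (.each 2 Procedure.markHits) s).literals = s.literals ∧
      (effect rows (.each 2 Procedure.markHits) s).row 0 = s.row 0 ∧
      (effect rows (.each 2 Procedure.markHits) s).row 1 = s.row 1 ∧
      (effect rows (.each 2 Procedure.markHits) s).hits =
        {j | ∃ y ∈ rows, Admissible s.literals (s.row 0) (s.row 1) y ∧ y j ≠ s.row 0 j} := by
  refine effect_each_induction (motive := fun l s' => s'.1.answer = s.1.answer ∧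
    s'.literals = s.literals ∧ s'.row 0 = s.row 0 ∧ s'.row 1 = s.row 1 ∧
    s'.hits = {j | ∃ y ∈ l, Admissible s.literals (s.row 0) (s.row 1) y ∧ y j ≠ s.row 0 j})
    (by simp [hs]) ?_
  rintro l y s' ⟨hanswer, hS, h₀, h₁, hhits⟩
  obtain ⟨hanswer', hS', hrow', hhits'⟩ := effect_markHits (rows := rows) (s := s'.write 2 y)
  refine ⟨by simp [*], by simp [*], by simp [*], by simp [*], ?_⟩
  ext j
  simp [*, or_and_right, exists_or]

theorem effect_extend :
    (effect rows Procedure.extend s).1.answer = s.1.answer ∧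
      (effect rows Procedure.extend s).row 0 = s.row 0 ∧
      (effect rows Procedure.extend s).literals =
        s.literals ∪ forced {x | x ∈ rows} s.literals (s.row 0) (s.row 1) := by
  rw [Procedure.extend, effect_seq, effect_update, effect_seq, effect_update]
  set s₀ : State m := (s.1, fun j => { s.2 j with hit := false }) with hs₀
  obtain ⟨hanswer, hS, h₀, h₁, hhits⟩ := effect_each_markHits (rows := rows) (s := s₀)
    (by simp [hs₀, State.hits])
  set s₁ := effect rows (.each 2 Procedure.markHits) s₀
  refine ⟨hanswer, h₀, ?_⟩
  ext ⟨j, b⟩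
  have hlit : (s₁.2 j).lit b = true ↔ (j, b) ∈ s.literals := Set.ext_iff.1 hS (j, b)
  have hhit : (s₁.2 j).hit = true ↔
      ∃ y ∈ rows, Admissible s.literals (s.row 0) (s.row 1) y ∧ y j ≠ s.row 0 j :=
    Set.ext_iff.1 hhits j
  have hrow₀ : (s₁.2 j).row 0 = s.row 0 j := congrFun h₀ j
  have hrow₁ : (s₁.2 j).row 1 = s.row 1 j := congrFun h₁ j
  rw [State.literals, Set.mem_ofPred_eq, Bool.or_eq_true, hlit, hrow₀, hrow₁, Set.mem_union]
  refine or_congr_right ?_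
  suffices (s.row 0 j = b ∧ s.row 1 j ≠ b) ∧
      (∀ y ∈ rows, Admissible s.literals (s.row 0) (s.row 1) y → y j = s.row 0 j) ↔
      s.row 0 j = b ∧ s.row 1 j ≠ b ∧
        ∀ y ∈ rows, Admissible s.literals (s.row 0) (s.row 1) y → y j = b by
    simpa [forced, ← Bool.not_eq_true, hhit] using this
  rw [and_assoc]
  exact and_congr_right fun h => by rw [h]

theorem effect_each_extend :
    (effect rows (.each 1 Procedure.extend) s).1.answer = s.1.answer ∧
      (effect rows (.each 1 Procedure.extend) s).literals = rows.foldl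
        (fun S z' => S ∪ forced {x | x ∈ rows} S (s.row 0) z') s.literals := by
  have h := effect_each_induction (rows := rows) (s := s) (i := 1) (p := Procedure.extend)
    (motive := fun l s' => s'.1.answer = s.1.answer ∧ s'.row 0 = s.row 0 ∧ s'.literals =
      l.foldl (fun S z' => S ∪ forced {x | x ∈ rows} S (s.row 0) z') s.literals)
    ⟨rfl, rfl, rfl⟩ ?_
  · exact ⟨h.1, h.2.2⟩
  rintro l z' s' ⟨hanswer, h₀, hS⟩
  obtain ⟨hanswer', h₀', hS'⟩ := effect_extend (rows := rows) (s := s'.write 1 z')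
  simp [*]

theorem effect_each_each_extend :
    (effect rows (.each 0 (.each 1 Procedure.extend)) s).1.answer = s.1.answer ∧
      (effect rows (.each 0 (.each 1 Procedure.extend)) s).literals = round rows s.literals := by
  refine effect_each_induction (motive := fun l s' => s'.1.answer = s.1.answer ∧ s'.literals =
    l.foldl (fun S z => rows.foldl (fun S z' => S ∪ forced {x | x ∈ rows} S z z') S) s.literals)
    ⟨rfl, rfl⟩ ?_
  rintro l z s' ⟨hanswer, hS⟩
  obtain ⟨hanswer', hS'⟩ := effect_each_extend (rows := rows) (s := s'.write 0 z)
  simp [*]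

theorem effect_rounds_extend :
    (effect rows (.rounds 3 (.each 0 (.each 1 Procedure.extend))) s).1.answer = s.1.answer ∧
      (effect rows (.rounds 3 (.each 0 (.each 1 Procedure.extend))) s).literals =
        (round rows)^[(word rows).length] s.literals := by
  rw [effect, den]
  have hanswer : Function.Semiconj (fun s : State m => s.1.answer)
      (effect rows (.each 0 (.each 1 Procedure.extend))) id := fun _ => effect_each_each_extend.1
  have hS : Function.Semiconj State.literals
      (effect rows (.each 0 (.each 1 Procedure.extend))) (round rows) :=
    fun _ => effect_each_each_extend.2
  exact ⟨(hanswer.iterate_right _ s).trans (by simp), hS.iterate_right _ s⟩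

theorem answer_effect_closure [NeZero m] (u : Bool) :
    (effect rows (Procedure.closure u) s).1.answer = true ↔
      s.1.answer = true ∨ (round rows)^[(word rows).length] {(0, u)} ≠ Set.univ := by
  rw [Procedure.closure, effect_seq, effect_seq, effect_seq, effect_assign, effect_test]
  obtain ⟨hanswer, hS⟩ := effect_rounds_extend (rows := rows)
    (s := effect rows (Procedure.start u) s)
  rw [(effect_start u).1] at hanswer
  rw [(effect_start u).2] at hS
  rw [← hS, ← hanswer, Ne, State.literals_eq_univ_iff]
  simp

theorem effect_compareSum :
    (effect rows Procedure.compareSum s).1.answer = s.1.answer ∧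
      (effect rows Procedure.compareSum s).row = s.row ∧
      ((effect rows Procedure.compareSum s).1.found = true ↔ s.1.found = true ∨
        s.row 3 = fun j => xor (xor (s.row 0 j) (s.row 1 j)) (s.row 2 j)) := by
  rw [Procedure.compareSum, effect_seq, effect_test, effect_assign]
  refine ⟨rfl, rfl, ?_⟩
  simp only [Bool.or_eq_true, decide_eq_true_eq, beq_iff_eq, funext_iff]
  rfl

theorem effect_testSum :
    ((effect rows Procedure.testSum s).1.answer = true ↔ s.1.answer = true ∧
        (fun j => xor (xor (s.row 0 j) (s.row 1 j)) (s.row 2 j)) ∈ rows) ∧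
      (effect rows Procedure.testSum s).row 0 = s.row 0 ∧
      (effect rows Procedure.testSum s).row 1 = s.row 1 := by
  have hfind := effect_each_induction (rows := rows) (i := 3) (p := Procedure.compareSum)
    (s := effect rows (.assign fun q => { q with found := false }) s)
    (motive := fun l s' => s'.1.answer = s.1.answer ∧ s'.row 0 = s.row 0 ∧ s'.row 1 = s.row 1 ∧
      s'.row 2 = s.row 2 ∧ (s'.1.found = true ↔
        (fun j => xor (xor (s.row 0 j) (s.row 1 j)) (s.row 2 j)) ∈ l))
    ⟨rfl, rfl, rfl, rfl, by simp [effect_assign]⟩ ?_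
  · obtain ⟨hanswer, h₀, h₁, -, hfound⟩ := hfind
    refine ⟨?_, h₀, h₁⟩
    rw [Procedure.testSum, effect_seq, effect_seq, effect_assign, Bool.and_eq_true, hanswer, hfound]
  rintro l w s' ⟨hanswer, h₀, h₁, h₂, hfound⟩
  obtain ⟨hanswer', hrow, hfound'⟩ := effect_compareSum (rows := rows) (s := s'.write 3 w)
  simp [*, eq_comm (a := w)]

theorem effect_each_testSum :
    ((effect rows (.each 2 Procedure.testSum) s).1.answer = true ↔ s.1.answer = true ∧
        ∀ z ∈ rows, (fun j => xor (xor (s.row 0 j) (s.row 1 j)) (z j)) ∈ rows) ∧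
      (effect rows (.each 2 Procedure.testSum) s).row 0 = s.row 0 := by
  have h := effect_each_induction (rows := rows) (s := s) (i := 2) (p := Procedure.testSum)
    (motive := fun l s' => (s'.1.answer = true ↔ s.1.answer = true ∧
        ∀ z ∈ l, (fun j => xor (xor (s.row 0 j) (s.row 1 j)) (z j)) ∈ rows) ∧
      s'.row 0 = s.row 0 ∧ s'.row 1 = s.row 1)
    (by simp) ?_
  · exact ⟨h.1, h.2.1⟩
  rintro l z s' ⟨hanswer, h₀, h₁⟩
  obtain ⟨hanswer', h₀', h₁'⟩ := effect_testSum (rows := rows) (s := s'.write 2 z)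
  simp [*, or_imp, forall_and, and_assoc]

theorem effect_each_each_testSum :
    ((effect rows (.each 1 (.each 2 Procedure.testSum)) s).1.answer = true ↔ s.1.answer = true ∧
        ∀ y ∈ rows, ∀ z ∈ rows, (fun j => xor (xor (s.row 0 j) (y j)) (z j)) ∈ rows) := by
  have h := effect_each_induction (rows := rows) (s := s) (i := 1)
    (p := .each 2 Procedure.testSum)
    (motive := fun l s' => (s'.1.answer = true ↔ s.1.answer = true ∧
        ∀ y ∈ l, ∀ z ∈ rows, (fun j => xor (xor (s.row 0 j) (y j)) (z j)) ∈ rows) ∧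
      s'.row 0 = s.row 0)
    (by simp) ?_
  · exact h.1
  rintro l y s' ⟨hanswer, h₀⟩
  obtain ⟨hanswer', h₀'⟩ := effect_each_testSum (rows := rows) (s := s'.write 1 y)
  simp [*, or_imp, forall_and, and_assoc]

theorem answer_effect_each_each_each_testSum :
    (effect rows (.each 0 (.each 1 (.each 2 Procedure.testSum))) s).1.answer = true ↔
      s.1.answer = true ∧ IsAffine {x | x ∈ rows} := by
  refine effect_each_induction (motive := fun l s' => s'.1.answer = true ↔ s.1.answer = true ∧
    ∀ x ∈ l, ∀ y ∈ rows, ∀ z ∈ rows, (fun j => xor (xor (x j) (y j)) (z j)) ∈ rows) (by simp) ?_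
  intro l x s' hanswer
  simp [effect_each_each_testSum, hanswer, or_imp, forall_and, and_assoc]

end Effect

/-- The flags at the start. -/
def Flags.initial : Flags := { ok := true, found := false, answer := true }

/-- The answer of the decision procedure on an instance. -/
def Instance.decision (I : Instance) : Bool :=
  (effect I.rows Procedure.decision (Flags.initial, fun _ => default)).1.answer

namespace Instance

variable (I : Instance)

instance : NeZero I.m := ⟨Nat.one_le_iff_ne_zero.1 I.m_pos⟩

theorem two_le_length_rows : 2 ≤ I.rows.length := by
  obtain ⟨x, hx, hxt⟩ := I.nondegenerate.exists_apply_eq 0 true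
  obtain ⟨y, hy, hyf⟩ := I.nondegenerate.exists_apply_eq 0 false
  have hne : x ≠ y := by
    rintro rfl
    exact absurd (hxt.symm.trans hyf) (by simp)
  exact (List.Nodup.subperm (l₁ := [x, y]) (by simpa using hne)
    (List.cons_subset.2 ⟨hx, List.cons_subset.2 ⟨hy, List.nil_subset _⟩⟩)).length_le

theorem rows_ne_nil : I.rows ≠ [] :=
  List.ne_nil_of_length_pos (by have := I.two_le_length_rows; omega)

theorem two_mul_le_length_word : 2 * I.m ≤ (word I.rows).length := by
  rw [length_word]
  exact Nat.mul_le_mul I.two_le_length_rows I.m.le_succ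

theorem decision_eq_true_iff :
    I.decision = true ↔ AdmitsNonDictatorial I.X 2 ∨ IsAffine I.X := by
  rw [Instance.X, admitsNonDictatorial_two_iff_round I.nondegenerate I.two_mul_le_length_word,
    decision, Procedure.decision, effect_seq, effect_seq, answer_effect_closure,
    answer_effect_closure, answer_effect_each_each_each_testSum, Bool.exists_bool]
  simp only [Flags.initial, true_and]
  tauto

end Instance

/-- The decision procedure runs in polynomial time on a stack machine. -/
noncomputable def decisionComputable :
    Turing.TM2ComputableInPolyTime Instance.encode Computability.encodeBool Instance.decision where
  tm := machine Cell.put Procedure.decision Flags.initial Flags.answer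
  inputAlphabet := Equiv.refl (Option Bool)
  outputAlphabet := Equiv.refl Bool
  time := 2 * Polynomial.X + 2 + Procedure.decision.time
  outputsFun I := by
    have h := machine_outputsInTime (put := Cell.put) (q₀ := Flags.initial)
      (answer := Flags.answer) Procedure.decision_wellFormed I.rows_ne_nil
    have hmap : List.map (Equiv.refl (Option Bool)).invFun I.encode = word I.rows := List.map_id _
    exact hmap.symm ▸ h.some

end Aggregation

/-- There is a Turing machine running in time polynomial in the length of the input word that
decides, given `X ⊆ {0,1}^m`, whether `X` is a possibility domain; equivalently, whether `X`
admits a binary non-dictatorial aggregator or is affine. -/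
theorem theorem2 :
    ∃ decide : Aggregation.Instance → Bool,
      Nonempty (Turing.TM2ComputableInPolyTime
        Aggregation.Instance.encode Computability.encodeBool decide) ∧
      ∀ I : Aggregation.Instance,
        (decide I = true ↔ Aggregation.IsPossibilityDomain I.X) ∧
        (decide I = true ↔
          (Aggregation.AdmitsNonDictatorial I.X 2 ∨ Aggregation.IsAffine I.X)) := by
  refine ⟨Aggregation.Instance.decision, ⟨Aggregation.decisionComputable⟩, fun I => ⟨?_, ?_⟩⟩
  · exact I.decision_eq_true_iff.trans (Aggregation.isPossibilityDomain_iff I.nondegenerate).symm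
  · exact I.decision_eq_true_iff
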